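/- Call a set $D\subset\mathbb{R}^2$ simply connected if it is path-connected and every simple closed curve in $D$ (the image of an injective continuous map from the circle to $D$) can be continuously shrunk to a point while remaining in $D$. Let $D\subset\mathbb{R}^2$ be compact and simply connected, and let $h:D\to\mathbb{R}^2$ be a homeomorphism onto its image $h(D)$ (with the subspace topologies). Then $h$ maps the boundary of $D$ exactly onto the boundary of $h(D)$, that is, $h(\partial D)=\partial (h(D))$, where $\partial$ denotes the topological boundary in $\mathbb{R}^2$. In particular, for $Q=[0,1]\times[0,1]$, every homeomorphism $h$ from $Q$ onto itself satisfies $h(\partial Q)=\partial Q$. -/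

import Mathlib

/-- A set `D` is simply connected if it is path-connected and every simple closed curve in `D`
(an injective continuous map from the circle to `D`) can be continuously shrunk to a point
while remaining in `D`. -/
def SimplyConnectedSet {X : Type*} [TopologicalSpace X] (D : Set X) : Prop :=
  IsPathConnected D ∧
    ∀ γ : C(Circle, D), Function.Injective γ → ContinuousMap.Nullhomotopic γ

/-- The unit square `[0,1] × [0,1]` in the Euclidean plane. -/
def unitSquare : Set (EuclideanSpace ℝ (Fin 2)) :=
  {x | ∀ i, x i ∈ Set.Icc (0 : ℝ) 1}

/-!
A compact set in the plane has the property that its interior points are recognised by the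
topology of the set alone, through extensions of continuous functions without zeros.

Suppose that `h` embeds a compact set `D`, that `x` is interior to `D` and that `h x` is not
interior to `L = h(D)`. Then there are points `q ∉ L` arbitrarily close to `h x`. Take a small
disc about such a `q` containing `h x`. The function `h⁻¹ - x` has no zeros on the part of `L`
outside the disc, and it extends without zeros to all of `L`: over the boundary circle because
the circle is one-dimensional (`ContinuousMap.exists_eqOn_ne_zero_on_sphere`), and then over `L`
by pushing `L` radially away from `q` (`ContinuousMap.exists_eqOn_diff_ball_ne_zero`). Composing
with `h` gives a function on `D` without zeros that equals `z - x` on a circle about `x` bounding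
a disc inside `D`. This is impossible (`exists_eq_zero_of_eq_sub_on_sphere`): on the disc the
function would have a continuous logarithm, whereas `z - x` has none on the circle.

So `h`, and by symmetry its inverse, maps interior points to interior points; as `D` and `h(D)`
are closed, boundary points go exactly to boundary points. The square is the case in which
`D` and `h(D)` coincide.
-/

open Set Metric Topology

/-! ### Nowhere vanishing functions on the plane and their logarithms -/

theorem ContinuousMap.exists_exp_eq_of_ne_zero (f : C(ℂ, ℂ)) (hf : ∀ z, f z ≠ 0) :
    ∃ g : C(ℂ, ℂ), ∀ z, Complex.exp (g z) = f z := by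
  obtain ⟨g, ⟨-, hg⟩, -⟩ := Complex.isCoveringMapOn_exp.existsUnique_continuousMap_lifts f
    (a₀ := 0) (e₀ := Complex.log (f 0)) (Complex.exp_log (hf 0)) hf
  exact ⟨g, fun z => congrFun hg z⟩

/-- There is no continuous logarithm on a circle: along one turn a logarithm of `z - p` gains
`2πi`. -/
theorem not_exists_exp_eq_sub_on_sphere {p : ℂ} {r : ℝ} (hr : 0 < r) (g : C(ℂ, ℂ))
    (hg : ∀ z ∈ sphere p r, Complex.exp (g z) = z - p) : False := by
  have hexp : ∀ θ : ℝ, Complex.exp (g (circleMap p r θ) - Complex.log r - θ * Complex.I) = 1 := by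
    intro θ
    have hr' : (r : ℂ) ≠ 0 := by exact_mod_cast hr.ne'
    rw [Complex.exp_sub, Complex.exp_sub, hg _ (circleMap_mem_sphere p hr.le θ),
      Complex.exp_log hr', circleMap_sub_center, circleMap_zero, mul_div_cancel_left₀ _ hr',
      div_self (Complex.exp_ne_zero _)]
  have hcont : Continuous fun θ : ℝ =>
      ((g (circleMap p r θ) - Complex.log r - θ * Complex.I) / (2 * Real.pi * Complex.I)).re := by
    have := continuous_circleMap p r
    fun_prop
  have hint : ∀ θ : ℝ, ∃ n : ℤ, g (circleMap p r θ) - Complex.log r - θ * Complex.I =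
      n * (2 * Real.pi * Complex.I) := fun θ => Complex.exp_eq_one_iff.1 (hexp θ)
  choose n hn using hint
  have hn' : ∀ θ : ℝ, ((g (circleMap p r θ) - Complex.log r - θ * Complex.I) /
      (2 * Real.pi * Complex.I)).re = n θ := by
    intro θ
    rw [hn, mul_div_cancel_right₀ _ Complex.two_pi_I_ne_zero, Complex.intCast_re]
  simp only [hn'] at hcont
  -- an integer-valued continuous function on the line is constant
  have hn_cont : Continuous n := Int.isClosedEmbedding_coe_real.isInducing.continuous_iff.2 hcont
  have hconst : n (2 * Real.pi) = n 0 := PreconnectedSpace.constant inferInstance hn_cont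
  have h0 := hn 0
  have h1 := hn (2 * Real.pi)
  have hc : circleMap p r (2 * Real.pi) = circleMap p r 0 := by simp [circleMap]
  rw [hconst, hc, ← h0] at h1
  apply Complex.two_pi_I_ne_zero
  push_cast at h1
  linear_combination -h1

/-- The no-retraction theorem for a disc, in the form that `z ↦ z - p` on the boundary circle has
no continuous extension to the disc without zeros. -/
theorem exists_eq_zero_of_eq_sub_on_sphere {p : ℂ} {r : ℝ} (hr : 0 < r) {F : ℂ → ℂ}
    (hF : ContinuousOn F (closedBall p r)) (hFs : ∀ z ∈ sphere p r, F z = z - p) :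
    ∃ z ∈ closedBall p r, F z = 0 := by
  by_contra! hne
  -- the radial retraction of the plane onto the disc
  let R : ℂ → ℂ := fun z => p + ((r / max r ‖z - p‖ : ℝ) : ℂ) * (z - p)
  have hpos : ∀ z, 0 < max r ‖z - p‖ := fun z => lt_max_of_lt_left hr
  have hRc : Continuous R := by
    have : Continuous fun z : ℂ => r / max r ‖z - p‖ :=
      continuous_const.div (by fun_prop) fun z => (hpos z).ne'
    fun_prop
  have hRm : ∀ z, R z ∈ closedBall p r := by
    intro z
    rw [mem_closedBall, dist_eq_norm, show R z - p = _ from add_sub_cancel_left _ _, norm_mul,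
      Complex.norm_real, Real.norm_of_nonneg (div_nonneg hr.le (hpos z).le), div_mul_eq_mul_div,
      div_le_iff₀ (hpos z)]
    exact mul_le_mul_of_nonneg_left (le_max_right _ _) hr.le
  have hRs : ∀ z ∈ sphere p r, R z = z := by
    intro z hz
    rw [mem_sphere, dist_eq_norm] at hz
    simp [R, hz, hr.ne']
  obtain ⟨g, hg⟩ := ContinuousMap.exists_exp_eq_of_ne_zero
    ⟨fun z => F (R z), hF.comp_continuous hRc hRm⟩ fun z => hne _ (hRm z)
  refine not_exists_exp_eq_sub_on_sphere (p := p) hr g fun z hz => ?_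
  rw [hg, ContinuousMap.coe_mk, hRs z hz, hFs z hz]

/-! ### Extending functions without zeros -/

/-- A zero-free function on a compact set `C` extends without zeros over any circle. A `C¹`
approximation of it takes the circle to a set with dense complement, so a small translate has no
zeros on the circle; the quotient by this translate is close to `1` on `C`, hence has a
logarithm there, which extends to the plane. -/
theorem ContinuousMap.exists_eqOn_ne_zero_on_sphere (f : C(ℂ, ℂ)) {C : Set ℂ} (hC : IsCompact C)
    (hf : ∀ z ∈ C, f z ≠ 0) (q : ℂ) (s : ℝ) :
    ∃ g : C(ℂ, ℂ), EqOn g f C ∧ ∀ z ∈ C ∪ sphere q s, g z ≠ 0 := by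
  obtain ⟨δ, hδ, hfδ⟩ : ∃ δ > 0, ∀ z ∈ C, δ ≤ ‖f z‖ := by
    rcases C.eq_empty_or_nonempty with rfl | hne
    · exact ⟨1, one_pos, by simp⟩
    · obtain ⟨z₀, hz₀, hmin⟩ := hC.exists_isMinOn hne (f := fun z => ‖f z‖) (by fun_prop)
      exact ⟨‖f z₀‖, norm_pos_iff.2 (hf z₀ hz₀), hmin⟩
  -- a smooth approximation on the compact set `C`
  obtain ⟨g₁, hg₁, hg₁f⟩ : ∃ g₁ : ℂ → ℂ, ContDiff ℝ 1 g₁ ∧ ∀ z ∈ C, ‖g₁ z - f z‖ < δ / 2 := by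
    have hopen := ContinuousMap.isOpen_setOfPred_mapsTo hC (isOpen_ball (x := (0 : ℂ)) (ε := δ / 2))
    obtain ⟨g₁, hmem, hsm⟩ := ContinuousMap.dense_setOfPred_contDiff.inter_open_nonempty
      ((fun g : C(ℂ, ℂ) => g - f) ⁻¹' {g | MapsTo g C (ball 0 (δ / 2))})
      (hopen.preimage (by fun_prop)) ⟨f, fun z _ => by simp [hδ]⟩
    refine ⟨g₁, ContDiff.of_le (mem_ofPred_eq ▸ hsm) (by exact_mod_cast le_top), fun z hz => ?_⟩
    simpa using hmem hz
  have hcirc : ContDiff ℝ 1 fun θ : ℝ => g₁ (circleMap q s θ) := hg₁.comp (contDiff_circleMap q s)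
  obtain ⟨c, hc, hcδ⟩ := (hcirc.dense_compl_range_of_finrank_lt_finrank
    (by simp)).inter_open_nonempty (ball 0 (δ / 2)) isOpen_ball ⟨0, by simp [hδ]⟩
  let g₂ : C(ℂ, ℂ) := ⟨fun z => g₁ z - c, by have := hg₁.continuous; fun_prop⟩
  have hclose : ∀ z ∈ C, ‖f z - g₂ z‖ < ‖f z‖ := by
    intro z hz
    have h1 := hg₁f z hz
    have h2 : ‖c‖ < δ / 2 := by simpa using hc
    calc ‖f z - g₂ z‖ = ‖c - (g₁ z - f z)‖ := by congr 1; simp [g₂]; ring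
      _ ≤ ‖c‖ + ‖g₁ z - f z‖ := norm_sub_le _ _
      _ < δ := by linarith
      _ ≤ ‖f z‖ := hfδ z hz
  have hg₂C : ∀ z ∈ C, g₂ z ≠ 0 := fun z hz h0 => by
    have := hclose z hz
    simp [h0] at this
  have hg₂S : ∀ z ∈ sphere q s, g₂ z ≠ 0 := by
    intro z hz h0
    have hs : 0 ≤ s := by
      rw [mem_sphere] at hz
      exact hz ▸ dist_nonneg
    rw [← abs_of_nonneg hs, ← range_circleMap] at hz
    obtain ⟨θ, rfl⟩ := hz
    exact hcδ ⟨θ, sub_eq_zero.1 h0⟩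
  -- `g₂ / f` lies in the disc of radius `1` about `1`, where the principal logarithm is continuous
  have hslit : ∀ z ∈ C, g₂ z / f z ∈ Complex.slitPlane := by
    intro z hz
    have hf0 := norm_pos_iff.2 (hf z hz)
    suffices h : ‖g₂ z / f z - 1‖ < 1 by
      simpa using Complex.mem_slitPlane_of_norm_lt_one h
    rw [div_sub_one (hf z hz), norm_div, div_lt_one hf0, norm_sub_rev]
    exact hclose z hz
  have hlog : ContinuousOn (fun z => Complex.log (g₂ z / f z)) C :=
    (ContinuousOn.div (by fun_prop) (by fun_prop) hf).clog hslit
  obtain ⟨u, hu⟩ := ContinuousMap.exists_restrict_eq hC.isClosed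
    ⟨_, continuousOn_iff_continuous_domRestrict.1 hlog⟩
  refine ⟨⟨fun z => g₂ z * Complex.exp (-u z), by fun_prop⟩, fun z hz => ?_, fun z hz => ?_⟩
  · have huz : u z = Complex.log (g₂ z / f z) := DFunLike.congr_fun hu ⟨z, hz⟩
    have := hg₂C z hz
    have := hf z hz
    simp only [ContinuousMap.coe_mk]
    rw [huz, Complex.exp_neg, Complex.exp_log (by positivity)]
    field_simp
  · exact mul_ne_zero (hz.elim (hg₂C z) (hg₂S z)) (Complex.exp_ne_zero _)

/-- A compact set `L` missing the centre of a disc can be pushed radially out of the disc, so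
zero-free functions on the part of `L` outside the disc extend over `L` without zeros. -/
theorem ContinuousMap.exists_eqOn_diff_ball_ne_zero (f : C(ℂ, ℂ)) {L : Set ℂ} (hL : IsCompact L)
    {q : ℂ} (hq : q ∉ L) {s : ℝ} (hf : ∀ z ∈ L \ ball q s, f z ≠ 0) :
    ∃ F : ℂ → ℂ, ContinuousOn F L ∧ EqOn F f (L \ ball q s) ∧ ∀ z ∈ L, F z ≠ 0 := by
  obtain ⟨g, hgf, hg⟩ := f.exists_eqOn_ne_zero_on_sphere (hL.diff isOpen_ball) hf q s
  let R : ℂ → ℂ := fun z => q + ((max 1 (s / ‖z - q‖) : ℝ) : ℂ) * (z - q)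
  have hpos : ∀ z ∈ L, 0 < ‖z - q‖ := fun z hz =>
    norm_pos_iff.2 (sub_ne_zero.2 fun h => hq (h ▸ hz))
  have hRc : ContinuousOn R L := by
    have : ContinuousOn (fun z : ℂ => s / ‖z - q‖) L :=
      continuousOn_const.div (by fun_prop) fun z hz => (hpos z hz).ne'
    have : ContinuousOn (fun z : ℂ => max 1 (s / ‖z - q‖)) L := continuousOn_const.sup this
    fun_prop
  have hRout : ∀ z ∈ L \ ball q s, R z = z := by
    intro z hz
    have h1 : s ≤ ‖z - q‖ := by simpa [dist_eq_norm] using hz.2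
    simp [R, max_eq_left ((div_le_one (hpos z hz.1)).2 h1)]
  have hRin : ∀ z ∈ L, z ∈ ball q s → R z ∈ sphere q s := by
    intro z hz hzb
    have h1 : ‖z - q‖ < s := by simpa [dist_eq_norm] using hzb
    have h2 : 1 ≤ s / ‖z - q‖ := (one_le_div (hpos z hz)).2 h1.le
    rw [mem_sphere, dist_eq_norm, show R z - q = _ from add_sub_cancel_left _ _, norm_mul,
      Complex.norm_real, max_eq_right h2, Real.norm_of_nonneg (zero_le_one.trans h2),
      div_mul_cancel₀ _ (hpos z hz).ne']
  refine ⟨fun z => g (R z), by fun_prop, fun z hz => ?_, fun z hz => hg _ ?_⟩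
  · simp only [hRout z hz, hgf hz]
  · by_cases hzb : z ∈ ball q s
    · exact .inr (hRin z hz hzb)
    · exact .inl (by rw [hRout z ⟨hz, hzb⟩]; exact ⟨hz, hzb⟩)

/-! ### Invariance of the interior -/

/-- Invariance of domain in the plane, for compact sources. -/
theorem mem_interior_range_of_mem_interior {D : Set ℂ} (hD : IsCompact D) {h : D → ℂ}
    (hh : IsEmbedding h) {x : D} (hx : (x : ℂ) ∈ interior D) : h x ∈ interior (range h) := by
  by_contra hy
  have : CompactSpace D := isCompact_iff_compactSpace.1 hD
  have hL : IsCompact (range h) := isCompact_range hh.continuous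
  obtain ⟨r, hr, hrD⟩ := Metric.nhds_basis_closedBall.mem_iff.1 (mem_interior_iff_mem_nhds.1 hx)
  -- points whose image is close to `h x` are in the open disc of radius `r`
  obtain ⟨ε, hε, hεr⟩ : ∃ ε > 0, ∀ z : D, h z ∈ ball (h x) ε → (z : ℂ) ∈ ball (x : ℂ) r := by
    have hn : {z : D | (z : ℂ) ∈ ball (x : ℂ) r} ∈ 𝓝 x :=
      continuous_subtype_val.continuousAt (ball_mem_nhds _ hr)
    rw [hh.isInducing.nhds_eq_comap] at hn
    obtain ⟨ε, hε, hsub⟩ := (Metric.nhds_basis_ball.comap h).mem_iff.1 hn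
    exact ⟨ε, hε, fun z hz => hsub hz⟩
  obtain ⟨q, hqx, hq⟩ : ∃ q ∈ ball (h x) (ε / 2), q ∉ range h := by
    by_contra! hsub
    exact hy (mem_interior_iff_mem_nhds.2
      (Filter.mem_of_superset (ball_mem_nhds _ (half_pos hε)) hsub))
  obtain ⟨f, hf⟩ := ContinuousMap.exists_extension'
    (hh.continuous.isClosedEmbedding hh.injective) ⟨fun z : D => (z : ℂ) - x, by fun_prop⟩
  have hfz : ∀ z : D, f (h z) = z - x := fun z => congrFun hf z
  obtain ⟨F, hFc, hFf, hF0⟩ := f.exists_eqOn_diff_ball_ne_zero hL hq (by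
    rintro _ ⟨⟨z, rfl⟩, hz⟩ h0
    rw [hfz, sub_eq_zero, Subtype.coe_inj] at h0
    exact hz (h0 ▸ mem_ball_comm.1 hqx))
  have hFh : Continuous fun z : D => F (h z) :=
    hFc.comp_continuous hh.continuous fun z => mem_range_self z
  obtain ⟨G, hG⟩ := ContinuousMap.exists_restrict_eq hD.isClosed ⟨_, hFh⟩
  have hGz : ∀ z : D, G z = F (h z) := fun z => DFunLike.congr_fun hG z
  obtain ⟨z, hz, hz0⟩ := exists_eq_zero_of_eq_sub_on_sphere hr (F := G) (by fun_prop) (by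
    intro z hz
    have hzD := hrD (sphere_subset_closedBall hz)
    rw [hGz ⟨z, hzD⟩, hFf, hfz]
    refine ⟨mem_range_self _, fun hb => ?_⟩
    have hzr := hεr ⟨z, hzD⟩ (ball_subset_ball' (by
      have := mem_ball.1 hqx
      linarith) hb)
    exact (mem_ball.1 hzr).ne hz)
  exact hF0 _ (mem_range_self _) ((hGz ⟨z, hrD hz⟩).symm.trans hz0)

theorem mem_interior_range_iff {D : Set ℂ} (hD : IsCompact D) {h : D → ℂ} (hh : IsEmbedding h)
    (x : D) : h x ∈ interior (range h) ↔ (x : ℂ) ∈ interior D := by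
  refine ⟨fun hx => ?_, mem_interior_range_of_mem_interior hD hh⟩
  have : CompactSpace D := isCompact_iff_compactSpace.1 hD
  let e := hh.toHomeomorph
  have := mem_interior_range_of_mem_interior (isCompact_range hh.continuous)
    (IsEmbedding.subtypeVal.comp e.symm.isEmbedding) (x := e x) hx
  rwa [range_comp, e.symm.surjective.range_eq, image_univ, Subtype.range_coe, Function.comp_apply,
    e.symm_apply_apply] at this

/-- Invariance of the boundary, for compact sets in any space homeomorphic to the plane. -/
theorem image_frontier_eq_frontier_range {E : Type*} [TopologicalSpace E] [T2Space E] (φ : E ≃ₜ ℂ)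
    {D : Set E} (hD : IsCompact D) {h : D → E} (hh : IsEmbedding h) :
    h '' {x : D | (x : E) ∈ frontier D} = frontier (range h) := by
  have : CompactSpace D := isCompact_iff_compactSpace.1 hD
  have key : ∀ x : D, h x ∈ interior (range h) ↔ (x : E) ∈ interior D := by
    intro x
    let k : (φ '' D) → ℂ := φ ∘ h ∘ (φ.image D).symm
    have hk : IsEmbedding k :=
      φ.isEmbedding.comp (hh.comp (φ.image D).symm.isEmbedding)
    have hrange : range k = φ '' range h := by
      rw [range_comp, (φ.image D).symm.surjective.range_comp]
    have := mem_interior_range_iff (hD.image φ.continuous) hk (φ.image D x)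
    rw [hrange, ← φ.image_interior, ← φ.image_interior] at this
    simpa [k, φ.injective.mem_set_image] using this
  rw [(isCompact_range hh.continuous).isClosed.frontier_eq, hD.isClosed.frontier_eq]
  ext y
  constructor
  · rintro ⟨x, hx, rfl⟩
    exact ⟨mem_range_self x, fun hy => hx.2 ((key x).1 hy)⟩
  · rintro ⟨⟨x, rfl⟩, hx⟩
    exact ⟨x, ⟨x.2, fun hy => hx ((key x).2 hy)⟩, rfl⟩

theorem isCompact_unitSquare : IsCompact unitSquare := by
  have : unitSquare = (EuclideanSpace.equiv (Fin 2) ℝ).toHomeomorph ⁻¹'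
      (univ.pi fun _ => Icc (0 : ℝ) 1) := by
    ext x
    simp only [unitSquare, mem_preimage, mem_univ_pi]
    rfl
  rw [this, Homeomorph.isCompact_preimage]
  exact isCompact_univ_pi fun _ => isCompact_Icc

theorem theorem2 :
    (∀ (D : Set (EuclideanSpace ℝ (Fin 2))) (h : D → EuclideanSpace ℝ (Fin 2)),
      IsCompact D → SimplyConnectedSet D → Topology.IsEmbedding h →
        h '' {x : D | (x : EuclideanSpace ℝ (Fin 2)) ∈ frontier D} = frontier (Set.range h)) ∧
    (∀ h : unitSquare ≃ₜ unitSquare,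
      h '' {x : unitSquare | (x : EuclideanSpace ℝ (Fin 2)) ∈ frontier unitSquare} =
        {x : unitSquare | (x : EuclideanSpace ℝ (Fin 2)) ∈ frontier unitSquare}) := by
  let φ : EuclideanSpace ℝ (Fin 2) ≃ₜ ℂ :=
    Complex.orthonormalBasisOneI.repr.symm.toHomeomorph
  refine ⟨fun D h hD _ hh => image_frontier_eq_frontier_range φ hD hh, fun h => ?_⟩
  have := image_frontier_eq_frontier_range φ isCompact_unitSquare
    (IsEmbedding.subtypeVal.comp h.isEmbedding)
  rw [range_comp, h.surjective.range_eq, image_univ, Subtype.range_coe, image_comp] at this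
  rw [← preimage_image_eq (h '' _) Subtype.val_injective, this]
  rfl
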